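/- Work over $\mathbb{C}$. For an integer $k \ge 0$ let $V(k)$ denote the simple module of dimension $k+1$ over the universal enveloping algebra $U(\mathfrak{sl}_2)$ (unique up to isomorphism), and let $\mathfrak{sl}_2$ act on tensor products by $x(m\otimes n) = xm\otimes n + m\otimes xn$. For $N\ge 0$ let $V(1)^{\otimes N}$ be the $N$-fold tensor power, with $V(1)^{\otimes 0} := V(0)$ the trivial module. A Catalan path of length $N$ is a function $f:\{0,1,\dots,N\}\to\mathbb{Z}$ with $f(0)=0$, $f(i)\ge 0$ for all $i$, and $|f(i)-f(i-1)|=1$ for $1\le i\le N$; it ends at height $k$ if $f(N)=k$. Let $\bar t(N,k)$ be the number of Catalan paths of length $N$ ending at height $k$. For every integer $N\ge 0$ there is a sequence $(t(k,N))_{k\ge 0}$ of non-negative integers such that $$V(1)^{\otimes N}\;\cong\;\bigoplus_{k\ge 0} V(k)^{\oplus t(k,N)}$$ as $U(\mathfrak{sl}_2)$-modules, and every such sequence satisfies $t(k,N)=\bar t(N,k)$ for all $k\ge 0$. In other words, the multiplicity of $V(k)$ in $V(1)^{\otimes N}$ equals the number of Catalan paths of length $N$ ending at height $k$. -/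

import Mathlib

open scoped TensorProduct DirectSum

noncomputable section

namespace SlTwo

/-- The Lie algebra `sl₂(ℂ)` of complex `2 × 2` matrices of trace zero, with basis
`e = E₀₁`, `f = E₁₀`, `h = E₀₀ - E₁₁`. -/
abbrev sl2 := LieAlgebra.SpecialLinear.sl (Fin 2) ℂ

/-- The universal enveloping algebra `U(sl₂)`. -/
abbrev U := UniversalEnvelopingAlgebra ℂ sl2

/-- A representation of `sl₂(ℂ)` on a complex vector space, bundled. -/
structure Rep where
  carrier : Type
  [addCommGroup : AddCommGroup carrier]
  [module : Module ℂ carrier]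
  [lieRingModule : LieRingModule sl2 carrier]
  [lieModule : LieModule ℂ sl2 carrier]

namespace Rep

instance : CoeSort Rep Type := ⟨Rep.carrier⟩

attribute [instance] addCommGroup module lieRingModule lieModule

/-- A representation of `sl₂` is a `U(sl₂)`-module: the action of `sl₂` extends uniquely
to an algebra homomorphism `U(sl₂) → End M`. -/
instance instModuleU (M : Rep) : Module U M :=
  Module.compHom M (UniversalEnvelopingAlgebra.lift ℂ (LieModule.toEnd ℂ sl2 M)).toRingHom

theorem u_smul_def (M : Rep) (u : U) (m : M) :
    u • m = UniversalEnvelopingAlgebra.lift ℂ (LieModule.toEnd ℂ sl2 M) u m := rfl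

theorem ι_smul (M : Rep) (x : sl2) (m : M) :
    UniversalEnvelopingAlgebra.ι ℂ x • m = ⁅x, m⁆ := by
  rw [u_smul_def, UniversalEnvelopingAlgebra.lift_ι_apply]
  rfl

instance (M : Rep) : IsScalarTower ℂ U M where
  smul_assoc c u m := by simp only [u_smul_def, map_smul, LinearMap.smul_apply]

/-- The tensor product of two representations, on which `x ∈ sl₂` acts by
`x (m ⊗ n) = x m ⊗ n + m ⊗ x n`. -/
def tensor (M N : Rep) : Rep where
  carrier := M ⊗[ℂ] N

theorem lie_tensor (M N : Rep) (x : sl2) (m : M) (n : N) :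
    (⁅x, (m ⊗ₜ[ℂ] n : M.tensor N)⁆ : M.tensor N) = ⁅x, m⁆ ⊗ₜ[ℂ] n + m ⊗ₜ[ℂ] ⁅x, n⁆ :=
  TensorProduct.LieModule.lie_tmul_right x m n

end Rep

section simple

attribute [local instance] LieRing.ofAssociativeRing

variable (k : ℕ)

/-- The action of `h` on `ℂ^{k+1}` with basis `v₀, …, v_k`: `h v_p = (k - 2p) v_p`. -/
def actH : Module.End ℂ (Fin (k + 1) → ℂ) where
  toFun g p := ((k : ℂ) - 2 * (p : ℕ)) * g p
  map_add' g₁ g₂ := by ext p; simp only [Pi.add_apply]; ring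
  map_smul' c g := by ext p; simp only [Pi.smul_apply, smul_eq_mul, RingHom.id_apply]; ring

/-- The action of `e` on `ℂ^{k+1}` with basis `v₀, …, v_k`: `e v₀ = 0` and
`e v_{p+1} = (k - p) v_p`. -/
def actE : Module.End ℂ (Fin (k + 1) → ℂ) where
  toFun g p := if hp : (p : ℕ) + 1 < k + 1 then ((k : ℂ) - (p : ℕ)) * g ⟨p + 1, hp⟩ else 0
  map_add' g₁ g₂ := by
    ext p; simp only [Pi.add_apply]; split_ifs <;> ring
  map_smul' c g := by
    ext p; simp only [Pi.smul_apply, smul_eq_mul, RingHom.id_apply]; split_ifs <;> ring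

/-- The action of `f` on `ℂ^{k+1}` with basis `v₀, …, v_k`: `f v_{p-1} = p v_p` for
`1 ≤ p ≤ k` and `f v_k = 0`. -/
def actF : Module.End ℂ (Fin (k + 1) → ℂ) where
  toFun g p := if 0 < (p : ℕ) then ((p : ℕ) : ℂ) * g ⟨p - 1, by omega⟩ else 0
  map_add' g₁ g₂ := by
    ext p; simp only [Pi.add_apply]; split_ifs <;> ring
  map_smul' c g := by
    ext p; simp only [Pi.smul_apply, smul_eq_mul, RingHom.id_apply]; split_ifs <;> ring

theorem act_e_f : ⁅actE k, actF k⁆ = actH k := by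
  refine LinearMap.ext fun g => funext fun p => ?_
  obtain ⟨p, hp⟩ := p
  rw [Ring.lie_def]
  simp only [actE, actF, actH, LinearMap.sub_apply, Module.End.mul_apply,
    LinearMap.coe_mk, AddHom.coe_mk, Pi.sub_apply]
  rcases Nat.eq_zero_or_pos p with rfl | h0
  · rcases Nat.eq_zero_or_pos k with rfl | hk
    · simp
    · simp [hk]
  · obtain ⟨q, rfl⟩ : ∃ q, p = q + 1 := ⟨p - 1, by omega⟩
    by_cases hk : q + 1 + 1 < k + 1
    · simp [hk, show q < k by omega]
      ring
    · obtain rfl : k = q + 1 := by omega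
      simp
      ring

theorem act_h_e : ⁅actH k, actE k⁆ = (2 : ℂ) • actE k := by
  refine LinearMap.ext fun g => funext fun p => ?_
  rw [Ring.lie_def]
  simp only [actE, actH, LinearMap.sub_apply, Module.End.mul_apply, LinearMap.smul_apply,
    LinearMap.coe_mk, AddHom.coe_mk, Pi.sub_apply, Pi.smul_apply, smul_eq_mul]
  split_ifs
  · push_cast; ring
  · ring

theorem act_h_f : ⁅actH k, actF k⁆ = (-2 : ℂ) • actF k := by
  refine LinearMap.ext fun g => funext fun p => ?_
  rw [Ring.lie_def]
  simp only [actF, actH, LinearMap.sub_apply, Module.End.mul_apply, LinearMap.smul_apply,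
    LinearMap.coe_mk, AddHom.coe_mk, Pi.sub_apply, Pi.smul_apply, smul_eq_mul]
  split_ifs with h
  · rw [Nat.cast_sub (show 1 ≤ (p : ℕ) from h)]; push_cast; ring
  · ring

/-- The action of a trace-zero matrix `x = x₀₀ h + x₀₁ e + x₁₀ f` on `ℂ^{k+1}`. -/
def act : sl2 →ₗ⁅ℂ⁆ Module.End ℂ (Fin (k + 1) → ℂ) where
  toFun x := x.val 0 0 • actH k + x.val 0 1 • actE k + x.val 1 0 • actF k
  map_add' x y := by
    have h (i j : Fin 2) : (x + y).val i j = x.val i j + y.val i j := rfl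
    simp only [h]
    module
  map_smul' c x := by
    have h (i j : Fin 2) : (c • x).val i j = c * x.val i j := rfl
    simp only [h, RingHom.id_apply]
    module
  map_lie' {x y} := by
    have hx : x.val 1 1 = - x.val 0 0 := by
      have h : Matrix.trace x.val = 0 := x.2
      rw [Matrix.trace_fin_two] at h
      exact eq_neg_of_add_eq_zero_right h
    have hy : y.val 1 1 = - y.val 0 0 := by
      have h : Matrix.trace y.val = 0 := y.2
      rw [Matrix.trace_fin_two] at h
      exact eq_neg_of_add_eq_zero_right h
    have hb : ⁅x, y⁆.val = x.val * y.val - y.val * x.val :=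
      LieAlgebra.SpecialLinear.sl_bracket _ _ x y
    have h1 : actE k * actF k = actF k * actE k + actH k :=
      eq_add_of_sub_eq' (act_e_f k)
    have h2 : actH k * actE k = actE k * actH k + (2 : ℂ) • actE k :=
      eq_add_of_sub_eq' (act_h_e k)
    have h3 : actH k * actF k = actF k * actH k + (-2 : ℂ) • actF k :=
      eq_add_of_sub_eq' (act_h_f k)
    simp only [Ring.lie_def, hb, Matrix.sub_apply, Matrix.mul_apply, Fin.sum_univ_two, hx, hy,
      add_mul, mul_add, smul_mul_assoc, mul_smul_comm, h1, h2, h3]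
    module

/-- The simple `U(sl₂)`-module `V(k)` of dimension `k + 1` (highest weight `k`). -/
def V : Rep :=
  letI : LieRingModule sl2 (Fin (k + 1) → ℂ) := LieRingModule.compLieHom _ (act k)
  haveI : LieModule ℂ sl2 (Fin (k + 1) → ℂ) := LieModule.compLieHom _ (act k)
  { carrier := Fin (k + 1) → ℂ }

theorem finrank_V : Module.finrank ℂ (V k) = k + 1 := 
  (Module.finrank_fin_fun ℂ : Module.finrank ℂ (Fin (k + 1) → ℂ) = k + 1)

theorem lie_V (x : sl2) (g : V k) : ⁅x, g⁆ = act k x g := rfl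

theorem lie_single_e (g : V k) :
    ⁅(LieAlgebra.SpecialLinear.single 0 1 (by decide) (1 : ℂ) : sl2), g⁆ = actE k g := by
  rw [lie_V]; simp [act]; rfl

theorem lie_single_f (g : V k) :
    ⁅(LieAlgebra.SpecialLinear.single 1 0 (by decide) (1 : ℂ) : sl2), g⁆ = actF k g := by
  rw [lie_V]; simp [act]; rfl

/-- A `U(sl₂)`-submodule of `V(k)` is stable under `e` and `f`. -/
theorem act_mem (W : Submodule U (V k)) (g : V k) (hg : g ∈ W) :
    (actE k g : V k) ∈ W ∧ (actF k g : V k) ∈ W := by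
  constructor
  · have := W.smul_mem (UniversalEnvelopingAlgebra.ι ℂ
      (LieAlgebra.SpecialLinear.single 0 1 (by decide) (1 : ℂ) : sl2)) hg
    rwa [Rep.ι_smul, lie_single_e] at this
  · have := W.smul_mem (UniversalEnvelopingAlgebra.ι ℂ
      (LieAlgebra.SpecialLinear.single 1 0 (by decide) (1 : ℂ) : sl2)) hg
    rwa [Rep.ι_smul, lie_single_f] at this

/-- `V(k)` is a simple `U(sl₂)`-module. -/
instance isSimpleModule_V : IsSimpleModule U (V k) := by
  have : Nontrivial (V k) := inferInstanceAs (Nontrivial (Fin (k + 1) → ℂ))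
  refine (isSimpleModule_iff ..).2 ⟨fun W => or_iff_not_imp_left.2 fun hW => ?_⟩
  let P : Submodule ℂ (Fin (k + 1) → ℂ) := W.restrictScalars ℂ
  have hE : ∀ g ∈ P, actE k g ∈ P := fun g hg => (act_mem k W g hg).1
  have hF : ∀ g ∈ P, actF k g ∈ P := fun g hg => (act_mem k W g hg).2
  obtain ⟨g, hg, hg0⟩ := W.exists_mem_ne_zero_of_ne_bot hW
  -- lowering the top index with `e` yields `v₀`
  have low : ∀ n : ℕ, ∀ hn : n < k + 1, ∀ g ∈ P, g ⟨n, hn⟩ ≠ 0 →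
      (∀ q : Fin (k + 1), n < q → g q = 0) → (Pi.single 0 1 : Fin (k + 1) → ℂ) ∈ P := by
    intro n
    induction n with
    | zero =>
      intro hn g hg h0 hq
      have : (Pi.single 0 1 : Fin (k + 1) → ℂ) = (g 0)⁻¹ • g := by
        ext q
        rcases eq_or_ne q 0 with rfl | hne
        · simp [inv_mul_cancel₀ (show g 0 ≠ 0 from h0)]
        · simp [hne, hq q (Fin.pos_of_ne_zero hne)]
      rw [this]
      exact P.smul_mem _ hg
    | succ n ih =>
      intro hn g hg h0 hq
      refine ih (by omega) _ (hE g hg) ?_ ?_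
      · have hkn : (k : ℂ) - n ≠ 0 := by
          rw [sub_ne_zero]; exact_mod_cast (show k ≠ n by omega)
        simp [actE, show n < k by omega, hkn, h0]
      · intro q hnq
        simp only [actE, LinearMap.coe_mk, AddHom.coe_mk]
        split_ifs with h
        · rw [hq ⟨q + 1, h⟩ (by simpa using hnq), mul_zero]
        · rfl
  have h0 : (Pi.single 0 1 : Fin (k + 1) → ℂ) ∈ P := by
    have hne : ∃ q : Fin (k + 1), (g : Fin (k + 1) → ℂ) q ≠ 0 := by
      by_contra! hall
      exact hg0 (funext hall)
    classical
    obtain ⟨q, hq, hmax⟩ := (Finset.univ.filter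
      fun q : Fin (k + 1) => (g : Fin (k + 1) → ℂ) q ≠ 0).exists_max_image id
        (hne.imp fun q hq => by simpa using hq)
    refine low q q.2 g hg (by simpa using hq) fun r hr => ?_
    by_contra hr0
    exact absurd (hmax r (by simpa using hr0)) (not_le.2 hr)
  have hall : ∀ n : ℕ, ∀ hn : n < k + 1, (Pi.single ⟨n, hn⟩ 1 : Fin (k + 1) → ℂ) ∈ P := by
    intro n
    induction n with
    | zero => exact fun _ => h0
    | succ n ih =>
      intro hn
      have hn1 : ((n : ℂ) + 1) ≠ 0 := by exact_mod_cast Nat.succ_ne_zero n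
      have : (Pi.single ⟨n + 1, hn⟩ 1 : Fin (k + 1) → ℂ) =
          ((n : ℂ) + 1)⁻¹ • actF k (Pi.single ⟨n, by omega⟩ 1) := by
        ext ⟨q, hq⟩
        simp only [actF, LinearMap.coe_mk, AddHom.coe_mk, Pi.smul_apply, smul_eq_mul,
          Pi.single_apply, Fin.mk.injEq]
        rcases eq_or_ne q (n + 1) with rfl | hne
        · simp [hn1]
        · have : ¬ (0 < q ∧ q - 1 = n) := by omega
          by_cases hq0 : 0 < q
          · simp [hne, show q - 1 ≠ n by omega]
          · simp [hne, hq0]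
      rw [this]
      exact P.smul_mem _ (hF _ (ih _))
  refine eq_top_iff.2 fun g _ => ?_
  have : (g : Fin (k + 1) → ℂ) ∈ P := by
    rw [pi_eq_sum_univ (g : Fin (k + 1) → ℂ)]
    refine P.sum_mem fun i _ => P.smul_mem _ ?_
    convert hall i i.2 using 1
    ext j
    simp [Pi.single_apply, eq_comm]
  exact this

end simple

/-- The tensor power `V(1)^{⊗N}`: `V(1)^{⊗0} = V(0)` is the trivial module, and
`V(1)^{⊗(N+1)} = V(1)^{⊗N} ⊗ V(1)`. -/
def tensorPower : ℕ → Rep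
  | 0 => V 0
  | N + 1 => (tensorPower N).tensor (V 1)

/-- `m 0, m 1, …` are multiplicities of the simple modules `V(0), V(1), …` in `M`:
`M ≅ ⨁_k V(k)^{⊕ m k}` as `U(sl₂)`-modules. -/
def IsMultiplicitySequence (M : Rep) (m : ℕ → ℕ) : Prop :=
  Nonempty (M ≃ₗ[U] ⨁ k : ℕ, (Fin (m k) → V k))

/-- A Catalan path of length `N`: a function `f : {0, …, N} → ℤ` with `f 0 = 0`,
nonnegative values, and steps `±1`. -/
def IsCatalanPath (N : ℕ) (f : Fin (N + 1) → ℤ) : Prop :=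
  f 0 = 0 ∧ (∀ i, 0 ≤ f i) ∧ ∀ i : Fin N, |f i.succ - f i.castSucc| = 1

/-- The set of Catalan paths of length `N` ending at height `k`. -/
def catalanPaths (N k : ℕ) : Set (Fin (N + 1) → ℤ) :=
  {f | IsCatalanPath N f ∧ f (Fin.last N) = k}

theorem finite_catalanPaths (N k : ℕ) : (catalanPaths N k).Finite := by
  refine (Set.finite_Icc (0 : Fin (N + 1) → ℤ) (fun i => (i : ℕ))).subset ?_
  rintro f ⟨⟨h0, hpos, hstep⟩, -⟩
  refine ⟨hpos, fun i => ?_⟩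
  induction i using Fin.induction with
  | zero => simp [h0]
  | succ i ih =>
    have := (abs_le.1 (hstep i).le).2
    simp only [Fin.val_castSucc, Fin.val_succ] at ih ⊢
    push_cast
    linarith

/-- The number of Catalan paths of length `N` ending at height `k`. -/
def catalanCount (N k : ℕ) : ℕ := (catalanPaths N k).ncard

end SlTwo

end

/-! Tensoring with V(1) moves a weight up or down by one: V(k) ⊗ V(1) ≅ V(k+1) ⊕ V(k-1) for k ≥ 1,
and V(0) ⊗ V(1) ≅ V(1) (`clebschGordan`). Each tensor factor thus adds one step to a path of
heights, and the missing summand at k = 0 is the condition that paths stay nonnegative. By induction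
on N, V(1)^{⊗N} is the direct sum of one copy of V(height p) for each Catalan path p
(`tensorPower_equiv_pi`); grouping paths by final height gives existence. For uniqueness, a
multiplicity of V(k) in any such decomposition equals the dimension of the space of vectors killed
by e on which h acts by k (`IsMultiplicitySequence.eq_finrank_highest`). That dimension depends on
the module alone, so any two multiplicity sequences agree. -/

noncomputable section

namespace SlTwo

/-! ### From sl₂-equivariance to U(sl₂)-linearity. -/

section LinearOfIota

attribute [local instance] LieRing.ofAssociativeRing

variable {M N : Type*} [AddCommGroup M] [AddCommGroup N] [Module ℂ M] [Module ℂ N]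
  [Module U M] [Module U N] [IsScalarTower ℂ U M] [IsScalarTower ℂ U N]

/-- The elements of `U(sl₂)` whose action commutes with a given linear map. -/
def commutant (φ : M →ₗ[ℂ] N) : Subalgebra ℂ U where
  carrier := {u | ∀ m, φ (u • m) = u • φ m}
  mul_mem' {u v} hu hv m := by rw [mul_smul, hu, hv, mul_smul]
  add_mem' {u v} hu hv m := by rw [add_smul, map_add, hu, hv, add_smul]
  algebraMap_mem' c m := by
    rw [Algebra.algebraMap_eq_smul_one, smul_assoc, one_smul, map_smul, smul_assoc, one_smul]

/-- By hypothesis ι lands in the subalgebra `commutant φ`, so it lifts to an algebra map from U into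
that subalgebra. Followed by the inclusion, this map is the identity, by uniqueness of lifts; hence
the subalgebra is all of U. -/
theorem map_u_smul (φ : M →ₗ[ℂ] N)
    (h : ∀ (x : sl2) (m : M),
      φ ((UniversalEnvelopingAlgebra.ι ℂ x : U) • m) =
        (UniversalEnvelopingAlgebra.ι ℂ x : U) • φ m)
    (u : U) (m : M) : φ (u • m) = u • φ m := by
  let i : sl2 →ₗ⁅ℂ⁆ commutant φ :=
    { toFun := fun x => ⟨UniversalEnvelopingAlgebra.ι ℂ x, h x⟩
      map_add' := fun x y => Subtype.ext (map_add _ x y)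
      map_smul' := fun c x => Subtype.ext (map_smul _ c x)
      map_lie' := fun {x y} => Subtype.ext (LieHom.map_lie _ x y) }
  have key : (commutant φ).val.comp (UniversalEnvelopingAlgebra.lift ℂ i) = AlgHom.id ℂ U := by
    apply UniversalEnvelopingAlgebra.hom_ext
    ext x
    change ((UniversalEnvelopingAlgebra.lift ℂ i (UniversalEnvelopingAlgebra.ι ℂ x) :
      commutant φ) : U) = UniversalEnvelopingAlgebra.ι ℂ x
    rw [UniversalEnvelopingAlgebra.lift_ι_apply]
    rfl
  have hu := (UniversalEnvelopingAlgebra.lift ℂ i u).2 m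
  have hv : ((UniversalEnvelopingAlgebra.lift ℂ i u : commutant φ) : U) = u :=
    DFunLike.congr_fun key u
  rwa [hv] at hu

/-- A linear equivalence commuting with `sl₂` is an isomorphism of `U(sl₂)`-modules. -/
def equivOfIota (φ : M ≃ₗ[ℂ] N)
    (h : ∀ (x : sl2) (m : M),
      φ ((UniversalEnvelopingAlgebra.ι ℂ x : U) • m) =
        (UniversalEnvelopingAlgebra.ι ℂ x : U) • φ m) : M ≃ₗ[U] N :=
  { φ with map_smul' := map_u_smul φ.toLinearMap h }

end LinearOfIota

/-! ### Clebsch–Gordan decomposition of V(k) ⊗ V(1). -/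

/-- Coordinates on `M ⊗ V(1)` with respect to the basis `v₀, v₁` of `V(1)`. -/
def tensorCoord (M : Rep) : M.tensor (V 1) ≃ₗ[ℂ] (Fin 2 → M) :=
  TensorProduct.piScalarRight ℂ ℂ M (Fin 2)

theorem tensorCoord_tmul (M : Rep) (m : M) (g : V 1) (i : Fin 2) :
    tensorCoord M (m ⊗ₜ[ℂ] g : M.tensor (V 1)) i = (g : Fin 2 → ℂ) i • m :=
  congrFun (TensorProduct.piScalarRightHom_tmul ℂ ℂ M (Fin 2) m g) i

theorem act_apply (k : ℕ) (x : sl2) (g : Fin (k + 1) → ℂ) (p : Fin (k + 1)) :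
    act k x g p = x.val 0 0 * (((k : ℂ) - 2 * (p : ℕ)) * g p) +
      x.val 0 1 * (if hp : (p : ℕ) + 1 < k + 1 then ((k : ℂ) - (p : ℕ)) * g ⟨p + 1, hp⟩ else 0) +
      x.val 1 0 * (if 0 < (p : ℕ) then ((p : ℕ) : ℂ) * g ⟨p - 1, by omega⟩ else 0) := rfl

/-- V(1) is the standard representation: besides acting on each coordinate, x mixes the two
coordinates by its own matrix, where x₁₁ = -x₀₀. -/
theorem tensorCoord_lie (M : Rep) (x : sl2) (z : M.tensor (V 1)) :
    tensorCoord M ⁅x, z⁆ 0 = ⁅x, tensorCoord M z 0⁆ + x.val 0 0 • tensorCoord M z 0 +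
        x.val 0 1 • tensorCoord M z 1 ∧
    tensorCoord M ⁅x, z⁆ 1 = ⁅x, tensorCoord M z 1⁆ - x.val 0 0 • tensorCoord M z 1 +
        x.val 1 0 • tensorCoord M z 0 := by
  induction z using TensorProduct.induction_on with
  | zero =>
    have h0 : (0 : M ⊗[ℂ] V 1) = (0 : M.tensor (V 1)) := rfl
    simp [h0]
  | add a b ha hb =>
    have h (c d : M.tensor (V 1)) : tensorCoord M ⁅x, c + d⁆ =
      tensorCoord M ⁅x, c⁆ + tensorCoord M ⁅x, d⁆ := by rw [lie_add, map_add]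
    have h' (c d : M.tensor (V 1)) : tensorCoord M (c + d) =
      tensorCoord M c + tensorCoord M d := map_add _ _ _
    constructor
    · refine (congrFun (h a b) 0).trans ?_
      erw [h' a b]
      simp only [Pi.add_apply, ha.1, hb.1, lie_add]
      module
    · refine (congrFun (h a b) 1).trans ?_
      erw [h' a b]
      simp only [Pi.add_apply, ha.2, hb.2, lie_add]
      module
  | tmul m g =>
    have h (i : Fin 2) : tensorCoord M ⁅x, (m ⊗ₜ[ℂ] g : M.tensor (V 1))⁆ i =
        (g : Fin 2 → ℂ) i • ⁅x, m⁆ + (act 1 x g : Fin 2 → ℂ) i • m := by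
      rw [Rep.lie_tensor, ← lie_V]
      exact (congrFun (map_add (tensorCoord M) _ _) i).trans
        (congrArg₂ _ (tensorCoord_tmul ..) (tensorCoord_tmul ..))
    have h' (i : Fin 2) := tensorCoord_tmul M m g i
    have a0 : (act 1 x g : Fin 2 → ℂ) 0 = x.val 0 0 * (g : Fin 2 → ℂ) 0 +
        x.val 0 1 * (g : Fin 2 → ℂ) 1 := by
      refine (act_apply 1 x g 0).trans ?_
      simp
    have a1 : (act 1 x g : Fin 2 → ℂ) 1 = -x.val 0 0 * (g : Fin 2 → ℂ) 1 +
        x.val 1 0 * (g : Fin 2 → ℂ) 0 := by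
      refine (act_apply 1 x g 1).trans ?_
      simp
      ring_nf
    constructor
    · erw [h, h', h', lie_smul, a0]
      module
    · erw [h, h', h', lie_smul, a1]
      module

/-- The inclusion `V(k+1) → V(k) ⊗ V(1)` in coordinates. -/
def inclUp (k : ℕ) : (Fin (k + 2) → ℂ) →ₗ[ℂ] (Fin 2 → Fin (k + 1) → ℂ) where
  toFun g := ![fun p => g p.castSucc, fun p => g p.succ]
  map_add' g g' := by ext i p; fin_cases i <;> rfl
  map_smul' c g := by ext i p; fin_cases i <;> rfl

/-- The inclusion `V(k) → V(k+1) ⊗ V(1)` in coordinates. -/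
def inclDown (k : ℕ) : (Fin (k + 1) → ℂ) →ₗ[ℂ] (Fin 2 → Fin (k + 2) → ℂ) where
  toFun g := ![fun p => if 0 < (p : ℕ) then ((p : ℕ) : ℂ) * g ⟨p - 1, by omega⟩ else 0,
    fun p => if hp : (p : ℕ) < k + 1 then -((k : ℂ) + 1 - (p : ℕ)) * g ⟨p, hp⟩ else 0]
  map_add' g g' := by
    ext i p; fin_cases i <;> simp <;> split_ifs <;> ring
  map_smul' c g := by
    ext i p; fin_cases i <;> simp <;> split_ifs <;> ring

/-- The map is v_q ↦ v_q ⊗ v₀ + v_{q-1} ⊗ v₁, which is f^q/q! applied to v₀ ⊗ v₀. The identities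
match `tensorCoord_lie`, so they express equivariance. -/
theorem inclUp_act (k : ℕ) (x : sl2) (g : Fin (k + 2) → ℂ) :
    inclUp k (act (k + 1) x g) 0 = act k x (inclUp k g 0) + x.val 0 0 • inclUp k g 0 +
      x.val 0 1 • inclUp k g 1 ∧
    inclUp k (act (k + 1) x g) 1 = act k x (inclUp k g 1) - x.val 0 0 • inclUp k g 1 +
      x.val 1 0 • inclUp k g 0 := by
  constructor
  · ext ⟨p, hp⟩
    simp only [Pi.add_apply, Pi.smul_apply, act_apply, smul_eq_mul]
    simp only [inclUp, LinearMap.coe_mk, AddHom.coe_mk, Matrix.cons_val_zero, Matrix.cons_val_one,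
      act_apply]
    rcases p with _ | p
    · by_cases h : 1 < k + 1
      · simp [h]
        ring
      · obtain rfl : k = 0 := by omega
        simp
    · by_cases h : p + 1 + 1 < k + 1
      · simp [h, show p < k by omega]
        ring
      · obtain rfl : k = p + 1 := by omega
        simp
        ring
  · ext ⟨p, hp⟩
    simp only [Pi.add_apply, Pi.sub_apply, Pi.smul_apply, act_apply, smul_eq_mul]
    simp only [inclUp, LinearMap.coe_mk, AddHom.coe_mk, Matrix.cons_val_zero, Matrix.cons_val_one,
      act_apply]
    rcases p with _ | p
    · by_cases h : 1 < k + 1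
      · simp [h, Nat.lt_of_succ_lt_succ h]
        ring
      · obtain rfl : k = 0 := by omega
        simp
        ring
    · by_cases h : p + 1 + 1 < k + 1
      · simp [h, show p + 1 < k by omega]
        ring
      · obtain rfl : k = p + 1 := by omega
        simp
        ring

/-- The map is v_q ↦ (q+1) v_{q+1} ⊗ v₀ - (k+1-q) v_q ⊗ v₁, which is f^q/q! applied to the highest
weight vector v₁ ⊗ v₀ - (k+1) v₀ ⊗ v₁. The coefficients p and k+1-p in `inclDown` vanish at the two
ends of the range, so the default values 0 there agree with the formula. -/
theorem inclDown_act (k : ℕ) (x : sl2) (g : Fin (k + 1) → ℂ) :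
    inclDown k (act k x g) 0 = act (k + 1) x (inclDown k g 0) + x.val 0 0 • inclDown k g 0 +
      x.val 0 1 • inclDown k g 1 ∧
    inclDown k (act k x g) 1 = act (k + 1) x (inclDown k g 1) - x.val 0 0 • inclDown k g 1 +
      x.val 1 0 • inclDown k g 0 := by
  constructor
  · ext ⟨p, hp⟩
    simp only [Pi.add_apply, Pi.smul_apply, act_apply, smul_eq_mul]
    simp only [inclDown, LinearMap.coe_mk, AddHom.coe_mk, Matrix.cons_val_zero,
      Matrix.cons_val_one, act_apply]
    rcases p with _ | p
    · simp
      ring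
    · by_cases h : p + 1 < k + 1
      · rcases p with _ | p
        · simp [h, Nat.lt_of_succ_lt_succ h]
          ring
        · simp [h, Nat.lt_of_succ_lt_succ h]
          ring
      · obtain rfl : p = k := by omega
        rcases p with _ | p
        · simp
          ring
        · simp
          ring
  · ext ⟨p, hp⟩
    simp only [Pi.add_apply, Pi.sub_apply, Pi.smul_apply, act_apply, smul_eq_mul]
    simp only [inclDown, LinearMap.coe_mk, AddHom.coe_mk, Matrix.cons_val_zero,
      Matrix.cons_val_one, act_apply]
    by_cases h : p < k + 1
    · rcases p with _ | p
      · by_cases h' : 0 < k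
        · simp [h']
          ring
        · obtain rfl : k = 0 := by omega
          simp
      · by_cases h' : p + 1 < k
        · simp [h', show p < k by omega, show p < k + 1 by omega]
          ring
        · obtain rfl : k = p + 1 := by omega
          simp
          ring
    · obtain rfl : p = k + 1 := by omega
      simp

/-- Clebsch–Gordan: `V(0) ⊗ V(1) ≅ V(1)`. -/
theorem clebschGordan_zero : Nonempty ((V 0).tensor (V 1) ≃ₗ[U] V 1) := by
  let ψ : V 1 →ₗ[ℂ] (V 0).tensor (V 1) :=
    (tensorCoord (V 0)).symm.toLinearMap ∘ₗ (inclUp 0 : (Fin 2 → ℂ) →ₗ[ℂ] (Fin 2 → Fin 1 → ℂ))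
  have hψ (g : V 1) : tensorCoord (V 0) (ψ g) = inclUp 0 g :=
    (tensorCoord (V 0)).apply_symm_apply _
  have hinj : Function.Injective ψ := by
    intro g g' h
    have h1 : inclUp 0 (g : Fin 2 → ℂ) = inclUp 0 (g' : Fin 2 → ℂ) := by rw [← hψ, ← hψ, h]
    funext i
    fin_cases i
    · exact congrFun (congrFun h1 0) 0
    · exact congrFun (congrFun h1 1) 0
  have : FiniteDimensional ℂ (V 1) := inferInstanceAs (FiniteDimensional ℂ (Fin 2 → ℂ))
  have : FiniteDimensional ℂ ((V 0).tensor (V 1)) :=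
    inferInstanceAs (FiniteDimensional ℂ ((Fin 1 → ℂ) ⊗[ℂ] (Fin 2 → ℂ)))
  have hrank : Module.finrank ℂ (V 1) = Module.finrank ℂ ((V 0).tensor (V 1)) := by
    have h := Module.finrank_tensorProduct (R := ℂ) (S := ℂ) (M := V 0) (M' := V 1)
    rw [finrank_V, finrank_V] at h
    rw [finrank_V]
    exact h.symm
  refine ⟨(equivOfIota (LinearEquiv.ofInjectiveOfFinrankEq ψ hinj hrank) fun x g => ?_).symm⟩
  change ψ _ = _ • ψ g
  rw [Rep.ι_smul, Rep.ι_smul]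
  apply (tensorCoord (V 0)).injective
  obtain ⟨h0, h1⟩ := tensorCoord_lie (V 0) x (ψ g)
  obtain ⟨h0', h1'⟩ := inclUp_act 0 x g
  rw [hψ] at h0 h1 ⊢
  funext i
  fin_cases i
  · exact h0'.trans h0.symm
  · exact h1'.trans h1.symm

/-- Clebsch–Gordan: `V(k+1) ⊗ V(1) ≅ V(k+2) ⊕ V(k)`. -/
theorem clebschGordan_succ (k : ℕ) :
    Nonempty ((V (k + 1)).tensor (V 1) ≃ₗ[U] V (k + 2) × V k) := by
  let Ψ : (Fin (k + 3) → ℂ) × (Fin (k + 1) → ℂ) →ₗ[ℂ] (Fin 2 → Fin (k + 2) → ℂ) :=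
    LinearMap.coprod (inclUp (k + 1)) (inclDown k)
  let ψ : (V (k + 2) × V k) →ₗ[ℂ] (V (k + 1)).tensor (V 1) :=
    (tensorCoord (V (k + 1))).symm.toLinearMap ∘ₗ Ψ
  have hψ (g : V (k + 2) × V k) : tensorCoord (V (k + 1)) (ψ g) = Ψ g :=
    (tensorCoord (V (k + 1))).apply_symm_apply _
  have hinj : Function.Injective ψ := by
    refine (injective_iff_map_eq_zero ψ).2 ?_
    rintro ⟨(g : Fin (k + 3) → ℂ), (g' : Fin (k + 1) → ℂ)⟩ h
    have h1 : inclUp (k + 1) g + inclDown k g' = 0 := by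
      have := hψ (g, g')
      rw [h, map_zero] at this
      exact this.symm
    have hx (p : Fin (k + 2)) := congrFun (congrFun h1 0) p
    have hy (p : Fin (k + 2)) := congrFun (congrFun h1 1) p
    simp only [inclUp, inclDown, LinearMap.coe_mk, AddHom.coe_mk, Pi.add_apply,
      Matrix.cons_val_zero, Matrix.cons_val_one, Pi.zero_apply] at hx hy
    -- The same entry of g occurs in coordinate 0 at p+1 and in coordinate 1 at p; subtracting
    -- leaves ((p+1) + (k+1-p)) g'(p) = (k+2) g'(p) = 0.
    have hg' : g' = 0 := by
      funext p
      have hxp := hx p.succ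
      have hyp := hy p.castSucc
      have e : (p.succ.castSucc : Fin (k + 3)) = p.castSucc.succ := rfl
      simp [e, p.is_le] at hxp hyp
      have hk : ((k : ℂ) + 2) ≠ 0 := by exact_mod_cast Nat.succ_ne_zero (k + 1)
      have : ((k : ℂ) + 2) * g' p = 0 := by linear_combination hxp - hyp
      exact (mul_eq_zero.1 this).resolve_left hk
    have hg : g = 0 := by
      funext p
      have h0 (q) : g' q = 0 := congrFun hg' q
      induction p using Fin.lastCases with
      | last => simpa using hy (Fin.last _)
      | cast p => simpa [h0] using hx p
    exact Prod.ext hg hg'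
  have hfin (k : ℕ) : FiniteDimensional ℂ (V k) :=
    inferInstanceAs (FiniteDimensional ℂ (Fin (k + 1) → ℂ))
  have : FiniteDimensional ℂ ((V (k + 1)).tensor (V 1)) :=
    inferInstanceAs (FiniteDimensional ℂ ((Fin (k + 2) → ℂ) ⊗[ℂ] (Fin 2 → ℂ)))
  -- Since (k+3) + (k+1) = 2(k+2), injectivity of ψ suffices.
  have hrank : Module.finrank ℂ (V (k + 2) × V k) =
      Module.finrank ℂ ((V (k + 1)).tensor (V 1)) := by
    have h := Module.finrank_tensorProduct (R := ℂ) (S := ℂ) (M := V (k + 1)) (M' := V 1)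
    rw [finrank_V, finrank_V] at h
    rw [Module.finrank_prod, finrank_V, finrank_V]
    refine Eq.trans ?_ h.symm
    ring
  refine ⟨(equivOfIota (LinearEquiv.ofInjectiveOfFinrankEq ψ hinj hrank) fun x g => ?_).symm⟩
  change ψ _ = _ • ψ g
  have hs : UniversalEnvelopingAlgebra.ι ℂ x • g = (⁅x, g.1⁆, ⁅x, g.2⁆) :=
    Prod.ext (Rep.ι_smul _ x g.1) (Rep.ι_smul _ x g.2)
  rw [hs, Rep.ι_smul]
  apply (tensorCoord (V (k + 1))).injective
  obtain ⟨h0, h1⟩ := tensorCoord_lie (V (k + 1)) x (ψ g)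
  have hact (G : Fin (k + 3) → ℂ) (G' : Fin (k + 1) → ℂ) :
      Ψ (act (k + 1 + 1) x G, act k x G') 0 = act (k + 1) x (Ψ (G, G') 0) +
        x.val 0 0 • Ψ (G, G') 0 + x.val 0 1 • Ψ (G, G') 1 ∧
      Ψ (act (k + 1 + 1) x G, act k x G') 1 = act (k + 1) x (Ψ (G, G') 1) -
        x.val 0 0 • Ψ (G, G') 1 + x.val 1 0 • Ψ (G, G') 0 := by
    obtain ⟨u0, u1⟩ := inclUp_act (k + 1) x G
    obtain ⟨d0, d1⟩ := inclDown_act k x G'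
    simp only [Ψ, LinearMap.coprod_apply, Pi.add_apply, u0, u1, d0, d1, map_add]
    constructor <;> module
  obtain ⟨e0, e1⟩ := hact g.1 g.2
  rw [hψ] at h0 h1 ⊢
  funext i
  fin_cases i
  · exact e0.trans h0.symm
  · exact e1.trans h1.symm

/-- The heights adjacent to `k`. -/
abbrev Neighbour (k : ℕ) : Type := {j : ℕ // |(j : ℤ) - k| = 1}

instance Neighbour.instFinite (k : ℕ) : Finite (Neighbour k) :=
  ((Set.finite_Iic (k + 1)).subset fun j (hj : |(j : ℤ) - k| = 1) => by
    have := (abs_le.1 hj.le).2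
    simp only [Set.mem_Iic]
    omega).to_subtype

/-- Clebsch–Gordan: `V(k) ⊗ V(1)` is the direct sum of the `V(j)` with `j ≥ 0` and
`|j - k| = 1`. -/
theorem clebschGordan (k : ℕ) :
    Nonempty ((V k).tensor (V 1) ≃ₗ[U] Π j : Neighbour k, V j.1) := by
  rcases k with _ | k
  · obtain ⟨e⟩ := clebschGordan_zero
    -- Neighbours are natural numbers, so -1 is excluded and only 1 remains.
    let a : Neighbour 0 := ⟨1, by simp⟩
    have ha (j : Neighbour 0) : j = a := by
      obtain ⟨j, hj⟩ := j
      refine Subtype.ext ?_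
      change j = 1
      rw [abs_eq (by norm_num)] at hj
      omega
    let φ : (Π j : Neighbour 0, V j.1) →ₗ[U] V 1 := LinearMap.proj a
    have hφ : Function.Bijective φ := by
      refine ⟨fun f g h => funext fun j => ?_, fun v => ?_⟩
      · rw [ha j]
        exact h
      · classical
        exact ⟨Function.update 0 a v,
          Function.update_self (β := fun j : Neighbour 0 => (V j.1 : Type)) a v 0⟩
    exact ⟨e.trans (LinearEquiv.ofBijective φ hφ).symm⟩
  · obtain ⟨e⟩ := clebschGordan_succ k
    let a : Neighbour (k + 1) := ⟨k + 2, by push_cast; ring_nf; simp⟩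
    let b : Neighbour (k + 1) := ⟨k, by simp⟩
    have hab : b ≠ a := fun h => by
      have : k = k + 2 := congrArg Subtype.val h
      omega
    have hj (j : Neighbour (k + 1)) : j = a ∨ j = b := by
      obtain ⟨j, hj⟩ := j
      have : j = k + 2 ∨ j = k := by
        rw [abs_eq (by norm_num)] at hj
        omega
      exact this.imp Subtype.ext Subtype.ext
    let φ : (Π j : Neighbour (k + 1), V j.1) →ₗ[U] V (k + 2) × V k :=
      LinearMap.prod (LinearMap.proj a) (LinearMap.proj b)
    have hφ : Function.Bijective φ := by
      refine ⟨fun f g h => funext fun j => ?_, fun v => ?_⟩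
      · rcases hj j with rfl | rfl
        · exact congrArg Prod.fst h
        · exact congrArg Prod.snd h
      · classical
        refine ⟨Function.update (Function.update 0 a v.1) b v.2, Prod.ext ?_ ?_⟩
        · exact (Function.update_of_ne hab.symm ..).trans (Function.update_self ..)
        · exact Function.update_self (β := fun j : Neighbour (k + 1) => (V j.1 : Type)) b v.2 _
    exact ⟨e.trans (LinearEquiv.ofBijective φ hφ).symm⟩

/-- Tensoring with `V(1)` distributes over finite direct sums. -/
theorem tensor_pi {ι : Type*} [Finite ι] (M : Rep) (S : ι → Rep)
    (e : M ≃ₗ[U] Π i, S i) (T : Rep) :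
    Nonempty (M.tensor T ≃ₗ[U] Π i, (S i).tensor T) := by
  classical
  have := Fintype.ofFinite ι
  let φ : M.tensor T ≃ₗ[ℂ] Π i, (S i).tensor T :=
    (TensorProduct.congr (e.restrictScalars ℂ) (LinearEquiv.refl ℂ T)) ≪≫ₗ
      TensorProduct.piLeft ℂ T (fun i => (S i : Type))
  have hφ (m : M) (t : T) (i : ι) : φ (m ⊗ₜ[ℂ] t : M.tensor T) i = e m i ⊗ₜ[ℂ] t := rfl
  refine ⟨equivOfIota φ fun x z => funext fun i => ?_⟩
  rw [Pi.smul_apply, Rep.ι_smul, Rep.ι_smul]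
  induction z using TensorProduct.induction_on with
  | zero =>
    have h0 : (0 : M ⊗[ℂ] T) = (0 : M.tensor T) := rfl
    simp [h0]
  | add a b ha hb =>
    have h (c d : M.tensor T) : φ (c + d) i = φ c i + φ d i := by rw [map_add]; rfl
    have h' (c d : M.tensor T) : φ ⁅x, c + d⁆ i = φ ⁅x, c⁆ i + φ ⁅x, d⁆ i := by
      rw [lie_add, h]
    refine (h' a b).trans ?_
    rw [ha, hb, ← lie_add]
    exact congrArg _ (h a b).symm
  | tmul m t =>
    have he : e ⁅x, m⁆ i = ⁅x, e m i⁆ := by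
      rw [← Rep.ι_smul, map_smul, Pi.smul_apply, Rep.ι_smul]
    rw [Rep.lie_tensor]
    refine (congrFun (map_add φ _ _) i).trans ?_
    rw [Pi.add_apply]
    erw [hφ, hφ, hφ, Rep.lie_tensor, he]
    rfl

/-! ### Catalan paths and the decomposition of the tensor power. -/

/-- Catalan paths of length `N`. -/
abbrev Path (N : ℕ) : Type := {f : Fin (N + 1) → ℤ // IsCatalanPath N f}

/-- The final height of a Catalan path. -/
def Path.height {N : ℕ} (p : Path N) : ℕ := (p.1 (Fin.last N)).toNat

theorem Path.coe_height {N : ℕ} (p : Path N) : (p.height : ℤ) = p.1 (Fin.last N) :=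
  Int.toNat_of_nonneg (p.2.2.1 _)

theorem isCatalanPath_snoc {N : ℕ} (f : Fin (N + 1) → ℤ) (j : ℤ) :
    IsCatalanPath (N + 1) (Fin.snoc f j : Fin (N + 2) → ℤ) ↔
      IsCatalanPath N f ∧ 0 ≤ j ∧ |j - f (Fin.last N)| = 1 := by
  have h0 : (Fin.snoc f j : Fin (N + 2) → ℤ) 0 = f 0 := Fin.snoc_castSucc (α := fun _ => ℤ) j f 0
  simp only [IsCatalanPath, h0, Fin.forall_fin_succ', Fin.snoc_castSucc, Fin.snoc_last,
    Fin.succ_castSucc, Fin.succ_last]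
  tauto

/-- Extend a Catalan path by one step. -/
def Path.snoc {N : ℕ} (s : Σ p : Path N, Neighbour p.height) : Path (N + 1) :=
  ⟨Fin.snoc s.1.1 (s.2.1 : ℤ), (isCatalanPath_snoc _ _).2
    ⟨s.1.2, Int.natCast_nonneg _, by rw [← Path.coe_height]; exact s.2.2⟩⟩

theorem Path.height_snoc {N : ℕ} (s : Σ p : Path N, Neighbour p.height) :
    (Path.snoc s).height = s.2.1 := by
  have h : (Path.snoc s).1 (Fin.last (N + 1)) = (s.2.1 : ℤ) :=
    Fin.snoc_last (α := fun _ => ℤ) (s.2.1 : ℤ) s.1.1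
  rw [Path.height, h, Int.toNat_natCast]

/-- The inverse deletes the last value, which is nonnegative and so is recovered from the natural
number `height`. -/
theorem Path.snoc_bijective (N : ℕ) :
    Function.Bijective (Path.snoc : (Σ p : Path N, Neighbour p.height) → Path (N + 1)) := by
  constructor
  · rintro ⟨p, j⟩ ⟨p', j'⟩ h
    have hp : p = p' := by
      have h' : (Fin.init (Path.snoc ⟨p, j⟩).1 : Fin (N + 1) → ℤ) =
        Fin.init (Path.snoc ⟨p', j'⟩).1 := by rw [h]
      simp only [Path.snoc, Fin.init_snoc] at h'
      exact Subtype.ext h'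
    subst hp
    have hj : j = j' := by
      have h' := congrArg Path.height h
      rw [Path.height_snoc, Path.height_snoc] at h'
      exact Subtype.ext h'
    rw [hj]
  · intro q
    have h : IsCatalanPath (N + 1)
        (Fin.snoc (Fin.init q.1 : Fin (N + 1) → ℤ) (q.1 (Fin.last _)) : Fin (N + 2) → ℤ) := by
      rw [Fin.snoc_init_self]
      exact q.2
    obtain ⟨h1, -, h2⟩ := (isCatalanPath_snoc _ _).1 h
    let p : Path N := ⟨Fin.init q.1, h1⟩
    refine ⟨⟨p, ⟨q.height, by rw [p.coe_height, q.coe_height]; exact h2⟩⟩, Subtype.ext ?_⟩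
    change Fin.snoc (Fin.init q.1) (q.height : ℤ) = q.1
    rw [Path.coe_height, Fin.snoc_init_self]

/-- A Catalan path of length `N + 1` is a Catalan path of length `N` with one more step. -/
def Path.snocEquiv (N : ℕ) : (Σ p : Path N, Neighbour p.height) ≃ Path (N + 1) :=
  Equiv.ofBijective _ (Path.snoc_bijective N)

instance Path.instSubsingletonZero : Subsingleton (Path 0) :=
  ⟨fun p q => Subtype.ext (funext fun i => by
    rw [Fin.fin_one_eq_zero i]
    exact p.2.1.trans q.2.1.symm)⟩

instance Path.instFinite (N : ℕ) : Finite (Path N) := by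
  induction N with
  | zero => infer_instance
  | succ N ih => exact Finite.of_equiv _ (Path.snocEquiv N)

/-- `V(a)` and `V(b)` are the same module if `a = b`. -/
def equivOfEq {a b : ℕ} (h : a = b) : V a ≃ₗ[U] V b := h ▸ LinearEquiv.refl U (V a)

/-- `V(1)^{⊗N}` is the direct sum over the Catalan paths `p` of length `N` of the modules
`V(k)`, where `k` is the final height of `p`. -/
theorem tensorPower_equiv_pi (N : ℕ) :
    Nonempty (tensorPower N ≃ₗ[U] Π p : Path N, V p.height) := by
  induction N with
  | zero =>
    let p : Path 0 := ⟨0, rfl, fun _ => le_rfl, fun i => i.elim0⟩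
    let φ : (Π p : Path 0, V p.height) →ₗ[U] V 0 := LinearMap.proj p
    have hφ : Function.Bijective φ := by
      refine ⟨fun f g h => funext fun j => ?_, fun v => ?_⟩
      · rw [Subsingleton.elim j p]
        exact h
      · classical
        exact ⟨Function.update 0 p v,
          Function.update_self (β := fun p : Path 0 => (V p.height : Type)) p v 0⟩
    exact ⟨(LinearEquiv.ofBijective φ hφ).symm⟩
  | succ N ih =>
    obtain ⟨e⟩ := ih
    obtain ⟨e₁⟩ := tensor_pi (tensorPower N) (fun p : Path N => V p.height) e (V 1)
    have e₂ (k : ℕ) := (clebschGordan k).some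
    -- Each summand splits by Clebsch–Gordan; the resulting double product is indexed by pairs
    -- (path, next height), that is, by paths of length N + 1.
    exact ⟨e₁ ≪≫ₗ LinearEquiv.piCongrRight (fun p : Path N => e₂ p.height) ≪≫ₗ
      (LinearEquiv.piCurry U
        (fun (p : Path N) (j : Neighbour p.height) => (V j.1 : Type))).symm ≪≫ₗ
      LinearEquiv.piCongrRight (fun s : Σ p : Path N, Neighbour p.height =>
        equivOfEq (Path.height_snoc s).symm) ≪≫ₗ
      LinearEquiv.piCongrLeft U (fun p : Path (N + 1) => (V p.height : Type))
        (Path.snocEquiv N)⟩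

/-! ### Grouping summands by height. -/

theorem natCard_fiber_height (N k : ℕ) :
    Nat.card {p : Path N // p.height = k} = catalanCount N k := by
  rw [catalanCount, ← Nat.card_coe_set_eq]
  refine Nat.card_congr
    { toFun := fun p => ⟨p.1.1, p.1.2, by rw [← Path.coe_height, p.2]⟩
      invFun := fun f => ⟨⟨f.1, f.2.1⟩, by
        have := f.2.2
        simp [Path.height, this]⟩
      left_inv := fun _ => rfl
      right_inv := fun _ => rfl }

/-- Grouping the summands of `⨁ᵢ V(w i)` by isomorphism class. -/
theorem isMultiplicitySequence_of_equiv_pi {ι : Type*} [Finite ι] (M : Rep) (w : ι → ℕ)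
    (e : M ≃ₗ[U] Π i, V (w i)) :
    IsMultiplicitySequence M fun k => Nat.card {i // w i = k} := by
  classical
  let t : ℕ → ℕ := fun k => Nat.card {i // w i = k}
  let ε : (Σ k, Fin (t k)) ≃ ι :=
    (Equiv.sigmaCongrRight fun k => (Finite.equivFin {i // w i = k}).symm).trans
      (Equiv.sigmaFiberEquiv w)
  have hε (s : Σ k, Fin (t k)) : w (ε s) = s.1 :=
    ((Finite.equivFin {i // w i = s.1}).symm s.2).2
  have : Finite (Σ k, Fin (t k)) := Finite.of_equiv ι ε.symm
  have := Fintype.ofFinite (Σ k, Fin (t k))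
  -- The finite product becomes a direct sum before currying, because k then ranges over all of ℕ;
  -- the inner finite sums become products again.
  exact ⟨e ≪≫ₗ (LinearEquiv.piCongrLeft U (fun i => (V (w i) : Type)) ε).symm ≪≫ₗ
    LinearEquiv.piCongrRight (fun s => equivOfEq (hε s)) ≪≫ₗ
    (DirectSum.linearEquivFunOnFintype U (Σ k, Fin (t k)) fun s => (V s.1 : Type)).symm ≪≫ₗ
    DirectSum.sigmaLcurryEquiv U (δ := fun k (_ : Fin (t k)) => (V k : Type)) ≪≫ₗ
    DFinsupp.mapRange.linearEquiv fun k =>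
      DirectSum.linearEquivFunOnFintype U (Fin (t k)) fun _ => (V k : Type)⟩

/-! ### Uniqueness of multiplicities via highest weight vectors. -/

/-- The element `e` of `U(sl₂)`. -/
def uE : U := UniversalEnvelopingAlgebra.ι ℂ
  (LieAlgebra.SpecialLinear.single 0 1 (by decide) (1 : ℂ) : sl2)

/-- The element `h` of `U(sl₂)`. -/
def uH : U := UniversalEnvelopingAlgebra.ι ℂ
  (LieAlgebra.SpecialLinear.singleSubSingle 0 1 (1 : ℂ) : sl2)

theorem u_smul_comm {M : Type*} [AddCommGroup M] [Module ℂ M] [Module U M] [IsScalarTower ℂ U M]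
    (u : U) (c : ℂ) (m : M) : u • c • m = c • u • m := by
  rw [← algebraMap_smul U c m, ← algebraMap_smul U c (u • m), ← mul_smul, ← mul_smul,
    Algebra.commutes]

/-- The highest weight vectors of weight `k` in `M`, together with zero. -/
def highest (M : Type*) [AddCommGroup M] [Module ℂ M] [Module U M] [IsScalarTower ℂ U M]
    (k : ℕ) : Submodule ℂ M where
  carrier := {m | uE • m = 0 ∧ uH • m = (k : ℂ) • m}
  zero_mem' := by simp
  add_mem' := by
    rintro a b ⟨ha, ha'⟩ ⟨hb, hb'⟩
    exact ⟨by rw [smul_add, ha, hb, add_zero], by rw [smul_add, ha', hb', smul_add]⟩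
  smul_mem' := by
    rintro c m ⟨h, h'⟩
    exact ⟨by rw [u_smul_comm, h, smul_zero], by rw [u_smul_comm, h', smul_comm]⟩

theorem uE_smul (k : ℕ) (g : V k) : uE • g = actE k g :=
  (Rep.ι_smul ..).trans (lie_single_e k g)

theorem uH_smul (k : ℕ) (g : V k) : uH • g = actH k g := by
  refine (Rep.ι_smul ..).trans ?_
  rw [lie_V]
  simp [act]
  rfl

/-- As e v_{p+1} = (k-p) v_p with k - p ≠ 0 for p < k, the kernel of e is the line through v₀. -/
theorem uE_smul_eq_zero_iff (k : ℕ) (g : V k) :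
    uE • g = 0 ↔ ∀ p : Fin k, (g : Fin (k + 1) → ℂ) p.succ = 0 := by
  rw [uE_smul]
  constructor
  · intro h p
    have hp : actE k g p.castSucc = (0 : ℂ) := congrFun h p.castSucc
    have hk : (k : ℂ) - p ≠ 0 := by
      rw [sub_ne_zero]
      exact_mod_cast p.2.ne'
    simp only [actE, LinearMap.coe_mk, AddHom.coe_mk, Fin.val_castSucc,
      dif_pos (Nat.succ_lt_succ p.2)] at hp
    exact (mul_eq_zero.1 hp).resolve_left hk
  · intro h
    funext p
    change (if hp : (p : ℕ) + 1 < k + 1 then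
      ((k : ℂ) - (p : ℕ)) * (g : Fin (k + 1) → ℂ) ⟨p + 1, hp⟩ else 0) = 0
    split_ifs with hp
    · rw [show (g : Fin (k + 1) → ℂ) ⟨p + 1, hp⟩ = 0 from h ⟨p, by omega⟩, mul_zero]
    · rfl

/-- The multiplicity of `V(k)` is the dimension of the space of highest weight vectors of
weight `k`. -/
theorem IsMultiplicitySequence.eq_finrank_highest {M : Rep} {t : ℕ → ℕ}
    (h : IsMultiplicitySequence M t) (k : ℕ) : t k = Module.finrank ℂ (highest M k) := by
  classical
  obtain ⟨e⟩ := h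
  -- φ reads off the v₀-coordinates in the copies of V(k); it turns out to be an isomorphism.
  let φ : highest M k →ₗ[ℂ] (Fin (t k) → ℂ) :=
    { toFun := fun m i => (e m.1 k i : Fin (k + 1) → ℂ) 0
      map_add' := fun m m' => by
        funext i
        simp only [Submodule.coe_add, map_add, DirectSum.add_apply, Pi.add_apply]
        rfl
      map_smul' := fun c m => by
        funext i
        have : e (c • m.1) = (algebraMap ℂ U c) • e m.1 := by
          rw [← algebraMap_smul U c m.1, map_smul]
        simp only [Submodule.coe_smul, this, DirectSum.smul_apply, Pi.smul_apply,
          algebraMap_smul]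
        rfl }
  have hcomp (u : U) (m : M) (j : ℕ) (i : Fin (t j)) : e (u • m) j i = u • e m j i := by
    rw [map_smul, DirectSum.smul_apply, Pi.smul_apply]
  have hinj : Function.Injective φ := by
    refine (injective_iff_map_eq_zero φ).2 fun m hm => ?_
    obtain ⟨hE, hH⟩ := m.2
    refine Subtype.ext (e.injective ?_)
    rw [ZeroMemClass.coe_zero, map_zero]
    refine DFinsupp.ext fun j => funext fun i => ?_
    have h1 : uE • e m.1 j i = 0 := by rw [← hcomp, hE, map_zero]; rfl
    rw [uE_smul_eq_zero_iff] at h1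
    have h2 : uH • e m.1 j i = (k : ℂ) • e m.1 j i := by
      rw [← hcomp, hH, ← algebraMap_smul U (k : ℂ) m.1, hcomp, algebraMap_smul]
    -- In V(j) the vector v₀ has weight j, so weight k forces this coordinate to vanish when j ≠ k;
    -- when j = k it vanishes because φ m = 0.
    have h3 : (e m.1 j i : Fin (j + 1) → ℂ) 0 = 0 := by
      by_cases hjk : j = k
      · subst hjk
        exact congrFun hm i
      · rw [uH_smul] at h2
        have h4 : ((j : ℂ) - 2 * (0 : ℕ)) * (e m.1 j i : Fin (j + 1) → ℂ) 0 =
          (k : ℂ) * (e m.1 j i : Fin (j + 1) → ℂ) 0 := congrFun h2 0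
        have h5 : (j : ℂ) - k ≠ 0 := by
          rw [sub_ne_zero]
          exact_mod_cast hjk
        refine (mul_eq_zero.1 (?_ : ((j : ℂ) - k) * _ = 0)).resolve_left h5
        linear_combination h4
    funext p
    induction p using Fin.cases with
    | zero => exact h3
    | succ p => exact h1 p
  have hsurj : Function.Surjective φ := by
    intro c
    let v : V k := (Pi.single 0 1 : Fin (k + 1) → ℂ)
    have hE : uE • v = 0 := (uE_smul_eq_zero_iff k v).2 fun p => by simp [v]
    have hH : uH • v = (k : ℂ) • v := by
      rw [uH_smul]
      funext p
      induction p using Fin.cases with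
      | zero =>
        change ((k : ℂ) - 2 * (0 : ℕ)) * _ = (k : ℂ) * _
        simp
      | succ p =>
        have hv : (v : Fin (k + 1) → ℂ) p.succ = 0 := by simp [v]
        change _ * (v : Fin (k + 1) → ℂ) p.succ = (k : ℂ) * (v : Fin (k + 1) → ℂ) p.succ
        rw [hv, mul_zero, mul_zero]
    let y : Fin (t k) → V k := fun i => c i • v
    let L := DirectSum.lof U ℕ (fun k => (Fin (t k) → V k)) k
    have hyE : uE • y = 0 := funext fun i => by
      change uE • c i • v = 0
      rw [u_smul_comm, hE, smul_zero]
    -- The weight is written as an element of U so that it passes through the U-linear maps `L` and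
    -- `e.symm`.
    have hyH : uH • y = algebraMap ℂ U k • y := funext fun i => by
      change uH • c i • v = algebraMap ℂ U k • c i • v
      rw [u_smul_comm, hH, algebraMap_smul, smul_comm]
    refine ⟨⟨e.symm (L y), ?_, ?_⟩, ?_⟩
    · rw [← map_smul, ← map_smul, hyE, map_zero, map_zero]
    · rw [← algebraMap_smul U, ← map_smul, ← map_smul, hyH, map_smul, map_smul]
    · funext i
      change (e (e.symm (L y)) k i : Fin (k + 1) → ℂ) 0 = c i
      rw [e.apply_symm_apply]
      have hL : L y k = y := DirectSum.lof_apply ..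
      rw [hL]
      change c i * (Pi.single 0 1 : Fin (k + 1) → ℂ) 0 = c i
      simp
  exact ((LinearEquiv.finrank_eq (LinearEquiv.ofBijective φ ⟨hinj, hsurj⟩)).trans
    (Module.finrank_fin_fun ℂ)).symm

end SlTwo

end

theorem proposition3p4 (N : ℕ) :
    (∃ t : ℕ → ℕ, SlTwo.IsMultiplicitySequence (SlTwo.tensorPower N) t) ∧
    ∀ t : ℕ → ℕ, SlTwo.IsMultiplicitySequence (SlTwo.tensorPower N) t →
      ∀ k : ℕ, t k = SlTwo.catalanCount N k := by
  obtain ⟨e⟩ := SlTwo.tensorPower_equiv_pi N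
  have h := SlTwo.isMultiplicitySequence_of_equiv_pi (SlTwo.tensorPower N) _ e
  refine ⟨⟨_, h⟩, fun t ht k => ?_⟩
  -- Both t and the sequence counting paths compute the dimension of the same space.
  rw [ht.eq_finrank_highest k, ← h.eq_finrank_highest k, SlTwo.natCard_fiber_height]
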